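/- For $\alpha>0$, $\beta\in\mathbb{R}$ let $E_{\alpha,\beta}(z)=\sum_{k=0}^\infty \frac{z^k}{\Gamma(\alpha k+\beta)}$ denote the Mittag-Leffler function. For any $0<\underline{\ell}<\overline{\ell}<\infty$ and $\alpha_0\in(0,1)$ there exist constants $\tilde C>0$ and $\hat C>0$, depending only on $\alpha_0,\underline{\ell},\overline{\ell}$, such that for every $\lambda_1\ge 0$, every $\alpha\in[\alpha_0,1)$ and every $\lambda>\lambda_1$ the function $$d_\alpha(t)=E_{\alpha,1}(-\lambda t^\alpha)-\exp(-\lambda t),\qquad t\in[\underline{\ell},\overline{\ell}],$$ is differentiable and satisfies $$\|d_\alpha\|_{L^\infty(\underline{\ell},\overline{\ell})}\le \tilde C\,(1-\alpha),\qquad \|\partial_t d_\alpha\|_{L^\infty(\underline{\ell},\overline{\ell})}\le \hat C\,\lambda\,(1-\alpha).$$ -/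

import Mathlib

open Set MeasureTheory
open scoped ENNReal

/-- The two-parametric Mittag-Leffler function `E_{α,β}(z) = ∑ₖ z ^ k / Γ(α k + β)`, for a real or
complex argument `z`. (`Real.Gamma` vanishes at its poles, so that there the summand is `0`, which
is the usual convention `1 / Γ = 0`.) -/
noncomputable def mittagLeffler {𝕜 : Type*} [RCLike 𝕜] (α β : ℝ) (z : 𝕜) : 𝕜 :=
  ∑' k : ℕ, z ^ k / ((Real.Gamma (α * k + β) : ℝ) : 𝕜)

/-- The function `d_α(t) = E_{α,1}(-lam t ^ α) - exp(-lam t)`. -/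
noncomputable def mlExpDiff (α lam t : ℝ) : ℝ :=
  mittagLeffler α 1 (-lam * t ^ α) - Real.exp (-lam * t)

open Complex Filter Topology
open scoped ComplexConjugate

/-! The function `E_{α,1}(-λ t^α)` has Laplace transform `s^(α-1) / (s^α + λ)`. Inverting it along
the parabola `s = z^2`, `Re z = 1`, writes `2π E_{α,1}(-λ t^α)` as the integral of `exp(t z^2)`
against `mlKernel α λ z`. Since `E_{1,1} = exp`, `2π d_α(t)` is the same integral of the difference
of the kernels for `α` and `1`. With `z = 1 + iu`, `|exp(t z^2)| = exp(t (1 - u^2))`, a Gaussian, so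
any bound on that difference that is polynomial in `|z|` can be integrated, also after the factor
`z^2` that `∂_t` produces.

The factor `1 - α` comes from `z^(2α-2) - 1` (`norm_cpow_sub_one_le`). Uniformity in `λ` comes from
lower bounds on `|z^(2α) + λ|` and `|z^2 + λ|` (`re_sq_le_norm_sq_add`, `le_mul_norm_sq_add`). The
representation itself, `parabolaIntegral_mlKernel`, is proved by matching Laplace transforms:
Cauchy's formula on one side, termwise integration of the series on the other, and uniqueness of the
transform. -/

/-! ### Cauchy's theorem and formula on a half-plane. -/

/-- **Cauchy's theorem for a half-plane**: the integral over a vertical line of a holomorphic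
function that decays quadratically to the right of it vanishes. -/
theorem integral_vertical_line_eq_zero {h : ℂ → ℂ} {b : ℝ} (hb1 : b < 1)
    (hd : DifferentiableOn ℂ h {z | b < z.re})
    {C R : ℝ} (hC : 0 ≤ C) (hb : ∀ z : ℂ, 1 ≤ z.re → R ≤ ‖z‖ → ‖h z‖ ≤ C / ‖z‖ ^ 2) :
    Integrable (fun u : ℝ => h (1 + u * I)) ∧ ∫ u : ℝ, h (1 + u * I) = 0 := by
  have hcont : Continuous fun u : ℝ => h (1 + u * I) :=
    hd.continuousOn.comp_continuous (by fun_prop) (by intro u; simpa using hb1)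
  have hnorm (u : ℝ) : 1 + u ^ 2 = ‖(1 + u * I : ℂ)‖ ^ 2 := by
    rw [← Complex.normSq_eq_norm_sq]
    simp [Complex.normSq_apply, pow_two]
  have hint : Integrable fun u : ℝ => h (1 + u * I) := by
    refine hcont.locallyIntegrable.integrable_of_isBigO_cocompact (g := fun u : ℝ => (1 + u ^ 2)⁻¹)
      ?_ (integrable_inv_one_add_sq.integrableAtFilter _)
    refine Asymptotics.IsBigO.of_bound C ?_
    filter_upwards [tendsto_norm_cocompact_atTop.eventually_ge_atTop R] with u hu
    have h1 : ‖u‖ ≤ ‖(1 + u * I : ℂ)‖ := by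
      simpa using Complex.abs_im_le_norm (1 + u * I : ℂ)
    have h2 := hb (1 + u * I) (by simp) (hu.trans h1)
    rw [← hnorm, div_eq_mul_inv] at h2
    rwa [Real.norm_of_nonneg (by positivity)]
  refine ⟨hint, ?_⟩
  have hlim : Tendsto (fun T : ℝ => ∫ u in (-T)..T, h (1 + u * I)) atTop
      (𝓝 (∫ u : ℝ, h (1 + u * I))) :=
    intervalIntegral_tendsto_integral hint tendsto_neg_atTop_atBot tendsto_id
  refine tendsto_nhds_unique hlim ?_
  -- On the rectangle `[1, 1 + T] × [-T, T]` the three other sides have total length `4T`, and `h`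
  -- is at most `C / T^2` there.
  have hz : Tendsto (fun T : ℝ => 4 * C / T) atTop (𝓝 0) := tendsto_const_nhds.div_atTop tendsto_id
  refine squeeze_zero_norm' ?_ hz
  filter_upwards [eventually_ge_atTop R, eventually_gt_atTop 0] with T hTR hT
  have key := integral_boundary_rect_eq_zero_of_differentiableOn h (1 - T * I) (1 + T + T * I)
    (hd.mono (by
      intro z hz
      have := hz.1
      simp only [sub_re, one_re, mul_re, ofReal_re, I_re, ofReal_im, I_im, add_re, mem_preimage] at this
      rw [uIcc_of_le (by linarith)] at this
      have := this.1
      simp only [mem_ofPred_eq]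
      linarith))
  simp only [sub_re, one_re, mul_re, ofReal_re, I_re, ofReal_im, I_im, add_re, sub_im, one_im,
    mul_im, add_im, mul_zero, mul_one, sub_zero, add_zero, zero_sub, zero_add, sub_self,
    ofReal_neg, ofReal_one, smul_eq_mul, ofReal_add] at key
  have bd (z : ℂ) (h1 : 1 ≤ z.re) (h2 : T ≤ ‖z‖) : ‖h z‖ ≤ C / T ^ 2 := by
    refine (hb z h1 (hTR.trans h2)).trans ?_
    gcongr
  have b1 : ‖∫ x : ℝ in (1 : ℝ)..1 + T, h (x + -T * I)‖ ≤ C / T ^ 2 * |1 + T - 1| := by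
    refine intervalIntegral.norm_integral_le_of_norm_le_const fun x hx => ?_
    rw [uIoc_of_le (by linarith)] at hx
    refine bd _ (by simpa using hx.1.le) ?_
    refine le_trans ?_ (Complex.abs_im_le_norm _)
    simp [abs_of_pos hT]
  have b2 : ‖∫ x : ℝ in (1 : ℝ)..1 + T, h (x + T * I)‖ ≤ C / T ^ 2 * |1 + T - 1| := by
    refine intervalIntegral.norm_integral_le_of_norm_le_const fun x hx => ?_
    rw [uIoc_of_le (by linarith)] at hx
    refine bd _ (by simpa using hx.1.le) ?_
    refine le_trans ?_ (Complex.abs_im_le_norm _)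
    simp [abs_of_pos hT]
  have b3 : ‖∫ y : ℝ in (-T)..T, h (1 + T + y * I)‖ ≤ C / T ^ 2 * |T - -T| := by
    refine intervalIntegral.norm_integral_le_of_norm_le_const fun x hx => ?_
    refine bd _ (by simpa using hT.le) ?_
    refine le_trans ?_ (Complex.abs_re_le_norm _)
    simp [abs_of_pos (show 0 < 1 + T by linarith)]
  have e : ‖∫ y : ℝ in (-T)..T, h (1 + y * I)‖ =
      ‖(∫ x : ℝ in (1 : ℝ)..1 + T, h (x + -T * I)) - (∫ x : ℝ in (1 : ℝ)..1 + T, h (x + T * I)) +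
        I * (∫ y : ℝ in (-T)..T, h (1 + T + y * I))‖ := by
    rw [sub_eq_zero.mp key]
    simp
  rw [e]
  refine (norm_add_le _ _).trans ?_
  refine (add_le_add (norm_sub_le _ _) le_rfl).trans ?_
  rw [norm_mul, norm_I, one_mul]
  refine (add_le_add (add_le_add b1 b2) b3).trans (le_of_eq ?_)
  rw [abs_of_pos (by linarith), abs_of_pos (by linarith)]
  field_simp
  ring

/-- On `Re z = 1` one has `z - 2 + conj w = -conj (z - w)`, so the integrand is `-1 / |z - w|^2`, a
Poisson kernel. -/
theorem integral_reflected_pole {w : ℂ} (hw : 1 < w.re) :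
    Integrable (fun u : ℝ => ((1 + u * I : ℂ) - 2 + conj w)⁻¹ * ((1 + u * I : ℂ) - w)⁻¹) ∧
    ∫ u : ℝ, (((1 + u * I : ℂ) - 2 + conj w)⁻¹ * ((1 + u * I : ℂ) - w)⁻¹) =
      -(Real.pi / (w.re - 1) : ℝ) := by
  set a := w.re - 1 with ha
  have ha0 : 0 < a := by simp [ha, hw]
  have e (u : ℝ) : ((1 + u * I : ℂ) - 2 + conj w)⁻¹ * ((1 + u * I : ℂ) - w)⁻¹ =
      ((-(a ^ 2)⁻¹ * (1 + ((u - w.im) / a) ^ 2)⁻¹ : ℝ) : ℂ) := by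
    rw [← mul_inv]
    have : ((1 + u * I : ℂ) - 2 + conj w) * ((1 + u * I : ℂ) - w) =
        ((-(a ^ 2 + (u - w.im) ^ 2) : ℝ) : ℂ) := by
      apply Complex.ext <;>
        simp only [ha, mul_re, mul_im, add_re, add_im, sub_re, sub_im, one_re, one_im, ofReal_re,
          ofReal_im, I_re, I_im, conj_re, conj_im, re_ofNat, im_ofNat] <;> ring
    rw [this, ← ofReal_inv]
    congr 1
    field_simp
  simp_rw [e]
  constructor
  · refine Integrable.ofReal (Integrable.const_mul ?_ _)
    exact ((integrable_inv_one_add_sq.comp_div ha0.ne').comp_sub_right w.im :)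
  rw [integral_complex_ofReal, integral_const_mul]
  have h1 := integral_sub_right_eq_self (μ := volume) (fun u : ℝ => (1 + (u / a) ^ 2)⁻¹) w.im
  rw [h1, Measure.integral_comp_div (fun u : ℝ => (1 + u ^ 2)⁻¹) a, integral_univ_inv_one_add_sq,
    abs_of_pos ha0]
  norm_cast
  simp only [smul_eq_mul]
  field_simp

/-- **Cauchy's integral formula for a half-plane**. -/
theorem integral_vertical_line_cauchy {g : ℂ → ℂ} (hd : DifferentiableOn ℂ g {z | 0 < z.re})
    {C : ℝ} (hb : ∀ z : ℂ, 1 ≤ z.re → ‖g z‖ ≤ C / ‖z‖) {w : ℂ} (hw : 1 < w.re) :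
    ∫ u : ℝ, g (1 + u * I) * (w - (1 + u * I))⁻¹ = 2 * Real.pi * g w := by
  set a := w.re - 1 with ha
  have ha0 : 0 < a := by simp [ha, hw]
  have hC : 0 ≤ C := by simpa using (norm_nonneg _).trans (hb 1 (by simp))
  -- The correction has its pole at `2 - conj w`, the mirror image of `w` in the line and so to its
  -- left. It cancels the value at `w` and keeps the decay `1/|z|`, so `dslope k w` is holomorphic
  -- on the right and decays quadratically.
  set k : ℂ → ℂ := fun z => g z - g w * (2 * a * (z - 2 + conj w)⁻¹) with hk
  have hkw : k w = 0 := by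
    have h1 : w - 2 + conj w = 2 * a := by
      apply Complex.ext <;> simp [ha] <;> ring
    have h2 : (a : ℂ) ≠ 0 := by exact_mod_cast ha0.ne'
    simp only [hk, h1]
    field_simp
    ring
  have hopen : IsOpen {z : ℂ | max 0 (1 - a) < z.re} := isOpen_lt continuous_const continuous_re
  have hkd : DifferentiableOn ℂ k {z | max 0 (1 - a) < z.re} := by
    refine (hd.mono fun z hz => mem_ofPred.2 ((le_max_left _ _).trans_lt (mem_ofPred.1 hz))).sub ?_
    refine DifferentiableOn.const_mul (DifferentiableOn.const_mul ?_ _) _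
    refine DifferentiableOn.inv (by fun_prop) fun z hz h0 => ?_
    have h1 := congrArg Complex.re h0
    have h2 : 1 - a < z.re := (le_max_right _ _).trans_lt (mem_ofPred.1 hz)
    simp at h1
    linarith
  have hwmem : w ∈ {z : ℂ | max 0 (1 - a) < z.re} := by
    simp only [mem_ofPred_eq, max_lt_iff]
    constructor <;> linarith
  have hds : DifferentiableOn ℂ (dslope k w) {z | max 0 (1 - a) < z.re} :=
    (Complex.differentiableOn_dslope (hopen.mem_nhds hwmem)).2 hkd
  have hval (z : ℂ) (hz : z ≠ w) : dslope k w z = k z * (z - w)⁻¹ := by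
    rw [dslope_of_ne _ hz, slope_def_field, hkw, sub_zero, div_eq_mul_inv]
  have hdecay (z : ℂ) (hz : 1 ≤ z.re) (hR : 2 * (‖w‖ + 2) ≤ ‖z‖) :
      ‖dslope k w z‖ ≤ ((C + ‖g w‖ * (2 * a * 2)) * 2) / ‖z‖ ^ 2 := by
    have hz0 : 0 < ‖z‖ := by have := norm_nonneg w; linarith
    have h1 : ‖z‖ / 2 ≤ ‖z - w‖ := by
      have := norm_sub_norm_le z w
      linarith
    have h2 : ‖z‖ / 2 ≤ ‖z - 2 + conj w‖ := by
      have h3 := norm_sub_norm_le z (2 - conj w)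
      have h4 : ‖2 - conj w‖ ≤ 2 + ‖w‖ := by simpa using norm_sub_le (2 : ℂ) (conj w)
      rw [show z - 2 + conj w = z - (2 - conj w) by ring]
      linarith
    rw [hval z (by rintro rfl; have := norm_nonneg z; linarith), norm_mul, norm_inv]
    have h3 : ‖k z‖ ≤ C / ‖z‖ + ‖g w‖ * (2 * a * (‖z‖ / 2)⁻¹) := by
      refine (norm_sub_le _ _).trans (add_le_add (hb z hz) ?_)
      rw [norm_mul, norm_mul, norm_inv, norm_mul, norm_real, Real.norm_of_nonneg ha0.le,
        RCLike.norm_ofNat]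
      gcongr
    calc ‖k z‖ * ‖z - w‖⁻¹ ≤ (C / ‖z‖ + ‖g w‖ * (2 * a * (‖z‖ / 2)⁻¹)) * (‖z‖ / 2)⁻¹ := by
          gcongr
      _ = _ := by field_simp
  obtain ⟨hi, h0⟩ := integral_vertical_line_eq_zero (max_lt one_pos (by linarith)) hds
    (by positivity) hdecay
  obtain ⟨hi', h0'⟩ := integral_reflected_pole hw
  have hne (u : ℝ) : (1 + u * I : ℂ) ≠ w := by
    rintro rfl
    simp at hw
  have e (u : ℝ) : g (1 + u * I) * (w - (1 + u * I))⁻¹ = -(dslope k w (1 + u * I)) -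
      (g w * (2 * a)) * (((1 + u * I : ℂ) - 2 + conj w)⁻¹ * ((1 + u * I : ℂ) - w)⁻¹) := by
    rw [hval _ (hne u), ← neg_sub (1 + u * I : ℂ) w, inv_neg]
    simp only [hk]
    ring
  simp_rw [e]
  rw [integral_sub (by exact hi.neg) (hi'.const_mul _), integral_neg, h0, integral_const_mul, h0']
  push_cast
  have h2 : (w.re - 1 : ℂ) ≠ 0 := by exact_mod_cast ha0.ne'
  simp only [ha, ofReal_sub, ofReal_one]
  field_simp
  ring

/-! ### Bounds on the kernel, uniform in `λ` for differences. -/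

theorem inv_norm_le_cpow_re {α : ℝ} (h0 : 0 < α) (h1 : α ≤ 1) {z : ℂ} (hz : 1 ≤ z.re) :
    ‖z‖⁻¹ ≤ (z ^ (α : ℂ)).re := by
  have hn : 1 ≤ ‖z‖ := hz.trans (re_le_norm z)
  have hz0 : z ≠ 0 := by rintro rfl; simp at hn; linarith
  rw [cpow_ofReal_re]
  have hc : ‖z‖⁻¹ ≤ Real.cos (arg z) := by
    rw [cos_arg hz0, inv_eq_one_div]
    gcongr
  have hc' : Real.cos (arg z) ≤ Real.cos (arg z * α) := by
    rw [← Real.cos_abs (arg z), ← Real.cos_abs (arg z * α), abs_mul, abs_of_pos h0]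
    refine Real.cos_le_cos_of_nonneg_of_le_pi (by positivity) (abs_arg_le_pi z) ?_
    exact mul_le_of_le_one_right (abs_nonneg _) h1
  calc ‖z‖⁻¹ ≤ 1 * Real.cos (arg z * α) := by rw [one_mul]; exact hc.trans hc'
    _ ≤ _ := by
      have : 0 ≤ Real.cos (arg z * α) := (by positivity : (0 : ℝ) ≤ ‖z‖⁻¹).trans (hc.trans hc')
      gcongr
      exact Real.one_le_rpow hn h0.le

/-- Both factors of `(ζ + i√λ)(ζ - i√λ)` have real part `Re ζ`, whatever `λ` is. -/
theorem re_sq_le_norm_sq_add {ζ : ℂ} (hζ : 0 ≤ ζ.re) {lam : ℝ} (hlam : 0 ≤ lam) :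
    ζ.re ^ 2 ≤ ‖ζ ^ 2 + lam‖ := by
  have e : ζ ^ 2 + lam = (ζ + (√lam : ℝ) * I) * (ζ - (√lam : ℝ) * I) := by
    have h1 : ((√lam : ℝ) : ℂ) ^ 2 = lam := by exact_mod_cast Real.sq_sqrt hlam
    linear_combination -h1 + ((√lam : ℝ) : ℂ) ^ 2 * I_sq
  have h1 : ζ.re ≤ ‖ζ + (√lam : ℝ) * I‖ := by simpa using re_le_norm (ζ + (√lam : ℝ) * I)
  have h2 : ζ.re ≤ ‖ζ - (√lam : ℝ) * I‖ := by simpa using re_le_norm (ζ - (√lam : ℝ) * I)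
  rw [e, norm_mul, pow_two]
  gcongr

theorem cpow_two_mul (α : ℝ) (z : ℂ) : z ^ ((2 * α : ℝ) : ℂ) = (z ^ (α : ℂ)) ^ 2 := by
  rw [← cpow_mul_nat]
  push_cast
  ring_nf

theorem inv_norm_sq_le_norm_cpow_add {α : ℝ} (h0 : 0 < α) (h1 : α ≤ 1) {z : ℂ} (hz : 1 ≤ z.re)
    {lam : ℝ} (hlam : 0 ≤ lam) : (‖z‖ ^ 2)⁻¹ ≤ ‖z ^ ((2 * α : ℝ) : ℂ) + lam‖ := by
  have h := inv_norm_le_cpow_re h0 h1 hz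
  have h' : (0 : ℝ) ≤ ‖z‖⁻¹ := by positivity
  rw [cpow_two_mul]
  refine le_trans ?_ (re_sq_le_norm_sq_add (h'.trans h) hlam)
  rw [← inv_pow]
  gcongr

theorem one_le_norm_sq_add {z : ℂ} (hz : 1 ≤ z.re) {lam : ℝ} (hlam : 0 ≤ lam) :
    1 ≤ ‖z ^ 2 + lam‖ :=
  (one_le_pow₀ hz).trans (re_sq_le_norm_sq_add (by linarith) hlam)

/-- This absorbs the factor `λ` of the kernel difference. If `λ ≤ 2|z|^2`, the bound `|z^2 + λ| ≥ 1`
is enough; otherwise `|z^2 + λ| ≥ λ - |z|^2 ≥ λ/2`. -/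
theorem le_mul_norm_sq_add {z : ℂ} (hz : 1 ≤ z.re) {lam : ℝ} (hlam : 0 ≤ lam) :
    lam ≤ 2 * ‖z‖ ^ 2 * ‖z ^ 2 + lam‖ := by
  have hn : 1 ≤ ‖z‖ := hz.trans (re_le_norm z)
  have hn2 : 1 ≤ ‖z‖ ^ 2 := one_le_pow₀ hn
  have h1 := one_le_norm_sq_add hz hlam
  rcases le_total lam (2 * ‖z‖ ^ 2) with h | h
  · nlinarith
  · have h2 : lam - ‖z‖ ^ 2 ≤ ‖z ^ 2 + lam‖ := by
      have := norm_sub_norm_le (lam : ℂ) (-z ^ 2)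
      rwa [norm_neg, norm_pow, norm_real, Real.norm_of_nonneg hlam, sub_neg_eq_add,
        add_comm (lam : ℂ)] at this
    nlinarith

theorem norm_exp_sub_one_le_of_re_nonpos {w : ℂ} (hw : w.re ≤ 0) : ‖exp w - 1‖ ≤ ‖w‖ := by
  have := (convex_halfSpace_re_le (0 : ℝ)).norm_image_sub_le_of_norm_deriv_le (f := exp) (C := 1)
    (x := 0) (y := w) (fun x _ => differentiable_exp x)
    (fun x hx => by
      rw [Complex.deriv_exp, norm_exp]
      exact Real.exp_le_one_iff.2 hx) (by simp) hw
  simpa using this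

theorem norm_log_le {z : ℂ} (hz : 1 ≤ z.re) : ‖log z‖ ≤ 4 * ‖z‖ := by
  have hn : 1 ≤ ‖z‖ := hz.trans (re_le_norm z)
  have h1 := norm_le_abs_re_add_abs_im (log z)
  rw [log_re, log_im, abs_of_nonneg (Real.log_nonneg hn)] at h1
  have h2 := Real.log_le_sub_one_of_pos (by linarith : 0 < ‖z‖)
  have h3 : |arg z| ≤ Real.pi / 2 := abs_arg_le_pi_div_two_iff.2 (by linarith)
  have := Real.pi_lt_four
  linarith

/-- The exponent `(2α - 2) log z` has nonpositive real part, where `exp` is 1-Lipschitz. This is the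
source of the factor `1 - α`. -/
theorem norm_cpow_sub_one_le {α : ℝ} (h1 : α ≤ 1) {z : ℂ} (hz : 1 ≤ z.re) :
    ‖z ^ ((2 * α - 2 : ℝ) : ℂ) - 1‖ ≤ 8 * (1 - α) * ‖z‖ := by
  have hn : 1 ≤ ‖z‖ := hz.trans (re_le_norm z)
  have hz0 : z ≠ 0 := by rintro rfl; simp at hn; linarith
  rw [cpow_def_of_ne_zero hz0]
  refine (norm_exp_sub_one_le_of_re_nonpos ?_).trans ?_
  · rw [re_mul_ofReal, log_re]
    exact mul_nonpos_of_nonneg_of_nonpos (Real.log_nonneg hn) (by linarith)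
  · rw [norm_mul, norm_real, Real.norm_of_nonpos (by linarith)]
    have := norm_log_le hz
    nlinarith

/-- The density, along the line `Re z = 1`, of the inverse Laplace transform of
`s ^ (α - 1) / (s ^ α + lam)` after the substitution `s = z ^ 2`. -/
noncomputable def mlKernel (α lam : ℝ) (z : ℂ) : ℂ :=
  2 * z * (z ^ ((2 * α - 2 : ℝ) : ℂ) / (z ^ ((2 * α : ℝ) : ℂ) + lam))

theorem cpow_two_mul_eq {z : ℂ} (hz : z ≠ 0) (α : ℝ) :
    z ^ ((2 * α : ℝ) : ℂ) = z ^ ((2 * α - 2 : ℝ) : ℂ) * z ^ 2 := by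
  rw [← cpow_ofNat, ← cpow_add _ _ hz]
  push_cast
  ring_nf

theorem mlKernel_sub_eq {α : ℝ} (h0 : 0 < α) (h1 : α ≤ 1) {z : ℂ} (hz : 1 ≤ z.re)
    {lam : ℝ} (hlam : 0 ≤ lam) :
    mlKernel α lam z - mlKernel 1 lam z = 2 * z * (lam * (z ^ ((2 * α - 2 : ℝ) : ℂ) - 1) /
      ((z ^ ((2 * α : ℝ) : ℂ) + lam) * (z ^ 2 + lam))) := by
  have hn : 1 ≤ ‖z‖ := hz.trans (re_le_norm z)
  have hz0 : z ≠ 0 := by rintro rfl; simp at hn; linarith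
  have hA : z ^ ((2 * α : ℝ) : ℂ) + lam ≠ 0 :=
    norm_pos_iff.1 (lt_of_lt_of_le (by positivity) (inv_norm_sq_le_norm_cpow_add h0 h1 hz hlam))
  have hB : z ^ 2 + (lam : ℂ) ≠ 0 :=
    norm_pos_iff.1 (lt_of_lt_of_le one_pos (one_le_norm_sq_add hz hlam))
  have e1 : z ^ ((2 * 1 : ℝ) : ℂ) = z ^ 2 := by rw [cpow_two_mul]; simp
  have e2 : z ^ ((2 * 1 - 2 : ℝ) : ℂ) = 1 := by norm_num
  unfold mlKernel
  rw [e1, e2]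
  rw [cpow_two_mul_eq hz0] at hA ⊢
  generalize z ^ ((2 * α - 2 : ℝ) : ℂ) = p at hA ⊢
  rw [← mul_sub, div_sub_div _ _ hA hB]
  ring

theorem norm_mlKernel_sub_le {α : ℝ} (h0 : 0 < α) (h1 : α ≤ 1) {z : ℂ} (hz : 1 ≤ z.re)
    {lam : ℝ} (hlam : 0 ≤ lam) :
    ‖mlKernel α lam z - mlKernel 1 lam z‖ ≤ 32 * (1 - α) * ‖z‖ ^ 6 := by
  have hn : 1 ≤ ‖z‖ := hz.trans (re_le_norm z)
  have hB := one_le_norm_sq_add hz hlam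
  have hA := inv_norm_sq_le_norm_cpow_add h0 h1 hz hlam
  have hl := le_mul_norm_sq_add hz hlam
  rw [mlKernel_sub_eq h0 h1 hz hlam]
  simp only [norm_mul, norm_div, norm_real, Real.norm_of_nonneg hlam, RCLike.norm_ofNat]
  calc 2 * ‖z‖ * (lam * ‖z ^ ((2 * α - 2 : ℝ) : ℂ) - 1‖ /
        (‖z ^ ((2 * α : ℝ) : ℂ) + lam‖ * ‖z ^ 2 + (lam : ℂ)‖))
      ≤ 2 * ‖z‖ * ((2 * ‖z‖ ^ 2 * ‖z ^ 2 + (lam : ℂ)‖) * (8 * (1 - α) * ‖z‖) /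
        ((‖z‖ ^ 2)⁻¹ * ‖z ^ 2 + (lam : ℂ)‖)) := by
        have := norm_cpow_sub_one_le h1 hz
        gcongr
    _ = _ := by field_simp; ring

/-- Here `λ` is kept rather than absorbed: the derivative estimate must be proportional to `λ`, even
for small `λ`. -/
theorem norm_mlKernel_sub_le_mul {α : ℝ} (h0 : 0 < α) (h1 : α ≤ 1) {z : ℂ} (hz : 1 ≤ z.re)
    {lam : ℝ} (hlam : 0 ≤ lam) :
    ‖mlKernel α lam z - mlKernel 1 lam z‖ ≤ 16 * lam * (1 - α) * ‖z‖ ^ 4 := by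
  have hn : 1 ≤ ‖z‖ := hz.trans (re_le_norm z)
  have hB := one_le_norm_sq_add hz hlam
  have hA := inv_norm_sq_le_norm_cpow_add h0 h1 hz hlam
  rw [mlKernel_sub_eq h0 h1 hz hlam]
  simp only [norm_mul, norm_div, norm_real, Real.norm_of_nonneg hlam, RCLike.norm_ofNat]
  calc 2 * ‖z‖ * (lam * ‖z ^ ((2 * α - 2 : ℝ) : ℂ) - 1‖ /
        (‖z ^ ((2 * α : ℝ) : ℂ) + lam‖ * ‖z ^ 2 + (lam : ℂ)‖))
      ≤ 2 * ‖z‖ * (lam * (8 * (1 - α) * ‖z‖) / ((‖z‖ ^ 2)⁻¹ * 1)) := by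
        have := norm_cpow_sub_one_le h1 hz
        gcongr
    _ = _ := by field_simp; ring

theorem norm_mlKernel_le {α : ℝ} (h0 : 0 < α) (h1 : α ≤ 1) {lam : ℝ} (hlam : 0 ≤ lam) :
    ∃ C, ∀ z : ℂ, 1 ≤ z.re → ‖mlKernel α lam z‖ ≤ C / ‖z‖ := by
  -- The ratio `z^(2α) / (z^(2α) + λ)` is at most `2` if `|z|^(2α) ≥ 2λ`. Otherwise `|z|^2 ≤
  -- (2λ)^(1/α)`, and the denominator is at least `|z|^(-2)`. Dependence on `λ` is harmless: this
  -- bound only serves convergence.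
  refine ⟨2 * (2 + 2 * lam * (2 * lam) ^ α⁻¹), fun z hz => ?_⟩
  have hn : 1 ≤ ‖z‖ := hz.trans (re_le_norm z)
  have hz0 : z ≠ 0 := by rintro rfl; simp at hn; linarith
  have hA := inv_norm_sq_le_norm_cpow_add h0 h1 hz hlam
  have hApos : 0 < ‖z ^ ((2 * α : ℝ) : ℂ) + lam‖ := lt_of_lt_of_le (by positivity) hA
  have e : mlKernel α lam z =
      2 * (z ^ ((2 * α : ℝ) : ℂ) / (z ^ ((2 * α : ℝ) : ℂ) + lam)) / z := by
    have := norm_pos_iff.1 hApos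
    unfold mlKernel
    rw [cpow_two_mul_eq hz0] at this ⊢
    field_simp
  rw [e, norm_div, norm_mul, RCLike.norm_ofNat, norm_div]
  gcongr
  rw [div_le_iff₀ hApos]
  set x := ‖z ^ ((2 * α : ℝ) : ℂ)‖ with hx
  have hxe : x = (‖z‖ ^ 2) ^ α := by
    rw [hx, norm_cpow_real, Real.rpow_mul (norm_nonneg z), Real.rpow_ofNat]
  rcases le_total (2 * lam) x with h | h
  · have h2 : x - lam ≤ ‖z ^ ((2 * α : ℝ) : ℂ) + lam‖ := by
      have := norm_sub_norm_le (z ^ ((2 * α : ℝ) : ℂ)) (-(lam : ℂ))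
      rwa [norm_neg, norm_real, Real.norm_of_nonneg hlam, sub_neg_eq_add] at this
    have : 0 ≤ 2 * lam * (2 * lam) ^ α⁻¹ := by positivity
    nlinarith
  · have h2 : ‖z‖ ^ 2 ≤ (2 * lam) ^ α⁻¹ := by
      rw [Real.le_rpow_inv_iff_of_pos (by positivity) (by positivity) h0, ← hxe]
      exact h
    calc x ≤ (2 * lam) * (‖z‖ ^ 2 * (‖z‖ ^ 2)⁻¹) := by
          rw [mul_inv_cancel₀ (by positivity), mul_one]; exact h
      _ ≤ (2 * lam) * ((2 * lam) ^ α⁻¹ * ‖z ^ ((2 * α : ℝ) : ℂ) + lam‖) := by gcongr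
      _ ≤ _ := by nlinarith

theorem cpow_re_pos {α : ℝ} (h0 : 0 < α) (h1 : α ≤ 1) {z : ℂ} (hz : 0 < z.re) :
    0 < (z ^ (α : ℂ)).re := by
  have hz0 : z ≠ 0 := by rintro rfl; simp at hz
  rw [cpow_ofReal_re]
  refine mul_pos (Real.rpow_pos_of_pos (norm_pos_iff.2 hz0) _) (Real.cos_pos_of_mem_Ioo ?_)
  have h2 : |arg z| < Real.pi / 2 := abs_arg_lt_pi_div_two_iff.2 (Or.inl hz)
  have h3 : |arg z * α| < Real.pi / 2 := by
    rw [abs_mul, abs_of_pos h0]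
    exact (mul_le_of_le_one_right (abs_nonneg _) h1).trans_lt h2
  exact ⟨(abs_lt.1 h3).1, (abs_lt.1 h3).2⟩

theorem differentiableOn_mlKernel {α : ℝ} (h0 : 0 < α) (h1 : α ≤ 1) {lam : ℝ} (hlam : 0 ≤ lam) :
    DifferentiableOn ℂ (mlKernel α lam) {z | 0 < z.re} := by
  intro z hz
  rw [mem_ofPred_eq] at hz
  have hs : z ∈ slitPlane := Or.inl hz
  have hne : z ^ ((2 * α : ℝ) : ℂ) + lam ≠ 0 := by
    rw [cpow_two_mul]
    have h2 := cpow_re_pos h0 h1 hz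
    exact norm_pos_iff.1 (lt_of_lt_of_le (by positivity) (re_sq_le_norm_sq_add h2.le hlam))
  refine DifferentiableAt.differentiableWithinAt ?_
  unfold mlKernel
  have hp (c : ℂ) : DifferentiableAt ℂ (fun z : ℂ => z ^ c) z :=
    differentiableAt_id.cpow_const hs
  exact (differentiableAt_id.const_mul 2).mul ((hp _).div ((hp _).add_const _) hne)

/-! ### Integrals over the parabola and their Laplace transforms. -/

theorem norm_one_add_mul_I_sq (u : ℝ) : ‖(1 + u * I : ℂ)‖ ^ 2 = 1 + u ^ 2 := by
  rw [← Complex.normSq_eq_norm_sq]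
  simp [Complex.normSq_apply, pow_two]

theorem re_one_add_mul_I_sq (u : ℝ) : ((1 + u * I : ℂ) ^ 2).re = 1 - u ^ 2 := by
  simp [pow_two]

theorem norm_exp_mul_one_add_mul_I_sq (t u : ℝ) :
    ‖exp (t * (1 + u * I : ℂ) ^ 2)‖ = Real.exp (t * (1 - u ^ 2)) := by
  rw [norm_exp, re_ofReal_mul, re_one_add_mul_I_sq]

theorem integrable_exp_mul_one_sub_sq_mul_pow {t : ℝ} (ht : 0 < t) (n : ℕ) :
    Integrable fun u : ℝ => Real.exp (t * (1 - u ^ 2)) * (1 + u ^ 2) ^ n := by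
  have h := (integrable_exp_neg_mul_sq (half_pos ht)).const_mul
    (Real.exp (3 * t / 2) * (n.factorial / (t / 2) ^ n))
  refine h.mono' (by fun_prop) (ae_of_all _ fun u => ?_)
  -- Half of the Gaussian exponent is spent on the polynomial, through `y^n ≤ n! e^y`.
  have h1 : (t / 2 * (1 + u ^ 2)) ^ n ≤ n.factorial * Real.exp (t / 2 * (1 + u ^ 2)) := by
    have := Real.pow_div_factorial_le_exp (t / 2 * (1 + u ^ 2)) (by positivity) n
    rwa [div_le_iff₀ (by positivity), mul_comm (Real.exp _)] at this
  rw [Real.norm_of_nonneg (by positivity)]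
  calc Real.exp (t * (1 - u ^ 2)) * (1 + u ^ 2) ^ n
      = Real.exp (t * (1 - u ^ 2)) * ((t / 2 * (1 + u ^ 2)) ^ n / (t / 2) ^ n) := by
        rw [mul_pow]; field_simp
    _ ≤ Real.exp (t * (1 - u ^ 2)) *
        (n.factorial * Real.exp (t / 2 * (1 + u ^ 2)) / (t / 2) ^ n) := by gcongr
    _ = (Real.exp (t * (1 - u ^ 2)) * Real.exp (t / 2 * (1 + u ^ 2))) *
        (n.factorial / (t / 2) ^ n) := by ring
    _ = (Real.exp (3 * t / 2) * Real.exp (-(t / 2) * u ^ 2)) * (n.factorial / (t / 2) ^ n) := by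
        rw [← Real.exp_add, ← Real.exp_add]; ring_nf
    _ = _ := by ring

/-- The inverse Laplace integral of `k` over the parabola `s = (1 + u i) ^ 2`, up to the factor
`2 π`. -/
noncomputable def parabolaIntegral (k : ℝ → ℂ) (t : ℝ) : ℂ :=
  ∫ u : ℝ, exp (t * (1 + u * I : ℂ) ^ 2) * k u

theorem norm_exp_mul_le {k : ℝ → ℂ} {C : ℝ} {n : ℕ} (hk : ∀ u, ‖k u‖ ≤ C * (1 + u ^ 2) ^ n)
    {a b t : ℝ} (hat : a ≤ t) (htb : t ≤ b) (u : ℝ) :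
    ‖exp (t * (1 + u * I : ℂ) ^ 2) * k u‖ ≤
      C * Real.exp (b - a) * (Real.exp (a * (1 - u ^ 2)) * (1 + u ^ 2) ^ n) := by
  rw [norm_mul, norm_exp_mul_one_add_mul_I_sq]
  have h1 : Real.exp (t * (1 - u ^ 2)) ≤ Real.exp (b - a) * Real.exp (a * (1 - u ^ 2)) := by
    rw [← Real.exp_add]
    gcongr
    nlinarith [mul_nonneg (sub_nonneg.2 hat) (sq_nonneg u)]
  calc _ ≤ (Real.exp (b - a) * Real.exp (a * (1 - u ^ 2))) * (C * (1 + u ^ 2) ^ n) :=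
        mul_le_mul h1 (hk u) (norm_nonneg _) (by positivity)
    _ = _ := by ring

theorem integrable_exp_mul {k : ℝ → ℂ} (hc : Continuous k) {C : ℝ} {n : ℕ}
    (hk : ∀ u, ‖k u‖ ≤ C * (1 + u ^ 2) ^ n) {t : ℝ} (ht : 0 < t) :
    Integrable fun u : ℝ => exp (t * (1 + u * I : ℂ) ^ 2) * k u :=
  ((integrable_exp_mul_one_sub_sq_mul_pow ht n).const_mul _).mono'
    (by fun_prop) (ae_of_all _ (norm_exp_mul_le hk le_rfl le_rfl))

theorem norm_parabolaIntegral_le {k : ℝ → ℂ} {C : ℝ} {n : ℕ}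
    (hk : ∀ u, ‖k u‖ ≤ C * (1 + u ^ 2) ^ n) {a b t : ℝ} (ha : 0 < a) (hat : a ≤ t) (htb : t ≤ b) :
    ‖parabolaIntegral k t‖ ≤
      C * Real.exp (b - a) * ∫ u : ℝ, Real.exp (a * (1 - u ^ 2)) * (1 + u ^ 2) ^ n := by
  rw [← integral_const_mul]
  exact norm_integral_le_of_norm_le ((integrable_exp_mul_one_sub_sq_mul_pow ha n).const_mul _)
    (ae_of_all _ (norm_exp_mul_le hk hat htb))

theorem hasDerivAt_parabolaIntegral {k : ℝ → ℂ} (hc : Continuous k) {C : ℝ} {n : ℕ}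
    (hk : ∀ u, ‖k u‖ ≤ C * (1 + u ^ 2) ^ n) {t : ℝ} (ht : 0 < t) :
    HasDerivAt (parabolaIntegral k)
      (parabolaIntegral (fun u => (1 + u * I : ℂ) ^ 2 * k u) t) t := by
  have hk' (u : ℝ) : ‖(1 + u * I : ℂ) ^ 2 * k u‖ ≤ C * (1 + u ^ 2) ^ (n + 1) := by
    rw [norm_mul, norm_pow, norm_one_add_mul_I_sq]
    calc _ ≤ (1 + u ^ 2) * (C * (1 + u ^ 2) ^ n) := by gcongr; exact hk u
      _ = _ := by ring
  refine (hasDerivAt_integral_of_dominated_loc_of_deriv_le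
    (F := fun (x : ℝ) (u : ℝ) => exp (x * (1 + u * I : ℂ) ^ 2) * k u)
    (F' := fun (x : ℝ) (u : ℝ) => exp (x * (1 + u * I : ℂ) ^ 2) * ((1 + u * I : ℂ) ^ 2 * k u))
    (Ioo_mem_nhds (half_lt_self ht) (lt_two_mul_self ht)) ?_ (integrable_exp_mul hc hk ht) ?_
    (ae_of_all _ fun u x hx => norm_exp_mul_le hk' hx.1.le hx.2.le u)
    ((integrable_exp_mul_one_sub_sq_mul_pow (half_pos ht) _).const_mul _)
    (ae_of_all _ fun u x _ => ?_)).2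
  · exact Eventually.of_forall fun x => by fun_prop
  · fun_prop
  · have h1 : HasDerivAt (fun x : ℝ => (x : ℂ) * (1 + u * I : ℂ) ^ 2) ((1 + u * I : ℂ) ^ 2) x := by
      simpa using (ofRealCLM.hasDerivAt (x := x)).mul_const ((1 + u * I : ℂ) ^ 2)
    simpa [mul_assoc] using h1.cexp.mul_const (k u)

/-- Since `Re σ ≥ 2` while `Re (1 + iu)^2 = 1 - u^2`, integrating the norm in `t` first leaves at
most `C / (1 + u^2)`. -/
theorem integrable_prod_exp_mul {k : ℝ → ℂ} (hc : Continuous k) {C : ℝ} (hk : ∀ u, ‖k u‖ ≤ C)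
    {σ : ℂ} (hσ : 2 ≤ σ.re) :
    Integrable (fun p : ℝ × ℝ => exp (-σ * p.1) * (exp (p.1 * (1 + p.2 * I : ℂ) ^ 2) * k p.2))
      ((volume.restrict (Ioi 0)).prod volume) := by
  have hnorm (t u : ℝ) : ‖exp (-σ * t) * (exp (t * (1 + u * I : ℂ) ^ 2) * k u)‖ =
      ‖k u‖ * Real.exp (-(σ.re - 1 + u ^ 2) * t) := by
    rw [norm_mul, norm_mul, norm_exp_mul_one_add_mul_I_sq, norm_exp, re_mul_ofReal, neg_re,
      ← mul_assoc, ← Real.exp_add, mul_comm]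
    ring_nf
  have hpos (u : ℝ) : 0 < σ.re - 1 + u ^ 2 := by nlinarith [sq_nonneg u]
  have hm : AEStronglyMeasurable
      (fun p : ℝ × ℝ => exp (-σ * p.1) * (exp (p.1 * (1 + p.2 * I : ℂ) ^ 2) * k p.2))
      ((volume.restrict (Ioi 0)).prod volume) := by
    apply Continuous.aestronglyMeasurable
    fun_prop
  rw [integrable_prod_iff' hm]
  constructor
  · refine ae_of_all _ fun u => ?_
    refine Integrable.mono' (g := fun t => ‖k u‖ * Real.exp (-(σ.re - 1 + u ^ 2) * t)) ?_
      (by fun_prop) (ae_of_all _ fun t => (hnorm t u).le)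
    exact (integrableOn_exp_mul_Ioi (neg_neg_of_pos (hpos u)) 0).const_mul _
  · simp_rw [hnorm, integral_const_mul]
    have e (u : ℝ) : ∫ t in Ioi (0 : ℝ), Real.exp (-(σ.re - 1 + u ^ 2) * t) =
        (σ.re - 1 + u ^ 2)⁻¹ := by
      rw [integral_exp_mul_Ioi (neg_neg_of_pos (hpos u)), mul_zero, Real.exp_zero, neg_div_neg_eq,
        one_div]
    simp_rw [e]
    refine (integrable_inv_one_add_sq.const_mul C).mono' ?_ (ae_of_all _ fun u => ?_)
    · refine (hc.norm.mul (Continuous.inv₀ (by fun_prop) fun u => (hpos u).ne')).aestronglyMeasurable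
    · have hC : 0 ≤ C := (norm_nonneg _).trans (hk u)
      rw [norm_mul, norm_norm, norm_inv, Real.norm_of_nonneg (hpos u).le]
      refine mul_le_mul (hk u) (inv_anti₀ (by positivity) (by linarith)) (inv_nonneg.2 (hpos u).le) hC

theorem integrableOn_exp_mul_parabolaIntegral {k : ℝ → ℂ} (hc : Continuous k) {C : ℝ}
    (hk : ∀ u, ‖k u‖ ≤ C) {σ : ℂ} (hσ : 2 ≤ σ.re) :
    IntegrableOn (fun t : ℝ => exp (-σ * t) * parabolaIntegral k t) (Ioi 0) := by
  have := (integrable_prod_exp_mul hc hk hσ).integral_prod_left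
  simp only [integral_const_mul] at this
  exact this

theorem laplace_parabolaIntegral {k : ℝ → ℂ} (hc : Continuous k) {C : ℝ}
    (hk : ∀ u, ‖k u‖ ≤ C) {σ : ℂ} (hσ : 2 ≤ σ.re) :
    ∫ t in Ioi (0 : ℝ), exp (-σ * t) * parabolaIntegral k t =
      ∫ u : ℝ, k u * (σ - (1 + u * I : ℂ) ^ 2)⁻¹ := by
  have := integral_integral_swap
    (f := fun t u : ℝ => exp (-σ * t) * (exp (t * (1 + u * I : ℂ) ^ 2) * k u))
    (integrable_prod_exp_mul hc hk hσ)
  simp only [integral_const_mul] at this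
  unfold parabolaIntegral
  rw [this]
  congr 1 with u
  have e (t : ℝ) : exp (-σ * t) * (exp (t * (1 + u * I : ℂ) ^ 2) * k u) =
      k u * exp ((-(σ - (1 + u * I : ℂ) ^ 2)) * t) := by
    rw [← mul_assoc, ← exp_add, mul_comm]
    ring_nf
  simp_rw [e]
  rw [integral_const_mul, integral_exp_mul_complex_Ioi]
  · rw [ofReal_zero, mul_zero, exp_zero, neg_div_neg_eq, one_div]
  · rw [neg_re, sub_re, re_one_add_mul_I_sq]
    nlinarith [sq_nonneg u]

theorem continuous_mlKernel_line {α : ℝ} (h0 : 0 < α) (h1 : α ≤ 1) {lam : ℝ} (hlam : 0 ≤ lam) :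
    Continuous fun u : ℝ => mlKernel α lam (1 + u * I) :=
  (differentiableOn_mlKernel h0 h1 hlam).continuousOn.comp_continuous (by fun_prop)
    (by intro u; simp)

theorem norm_mlKernel_line_le {α : ℝ} (h0 : 0 < α) (h1 : α ≤ 1) {lam : ℝ} (hlam : 0 ≤ lam) :
    ∃ C, ∀ u : ℝ, ‖mlKernel α lam (1 + u * I)‖ ≤ C := by
  obtain ⟨C, hC⟩ := norm_mlKernel_le h0 h1 hlam
  refine ⟨C, fun u => ?_⟩
  have hC0 : 0 ≤ C := by simpa using (norm_nonneg _).trans (hC 1 (by simp))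
  have h2 : 1 ≤ ‖(1 + u * I : ℂ)‖ := by simpa using re_le_norm (1 + u * I : ℂ)
  exact (hC _ (by simp)).trans (div_le_self hC0 h2)

theorem laplace_parabolaIntegral_mlKernel {α : ℝ} (h0 : 0 < α) (h1 : α ≤ 1) {lam : ℝ}
    (hlam : 0 ≤ lam) {w : ℂ} (hw : 0 < w.re) (hw2 : 2 ≤ (w ^ 2).re) :
    ∫ t in Ioi (0 : ℝ), exp (-w ^ 2 * t) *
        parabolaIntegral (fun u => mlKernel α lam (1 + u * I)) t =
      2 * Real.pi * (w ^ ((2 * α - 2 : ℝ) : ℂ) / (w ^ ((2 * α : ℝ) : ℂ) + lam)) := by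
  have hw1 : 1 < w.re := by
    have : (w ^ 2).re = w.re ^ 2 - w.im ^ 2 := by simp [pow_two]
    nlinarith [sq_nonneg w.im]
  obtain ⟨C, hC⟩ := norm_mlKernel_line_le h0 h1 hlam
  rw [laplace_parabolaIntegral (continuous_mlKernel_line h0 h1 hlam) hC hw2]
  obtain ⟨C', hC'⟩ := norm_mlKernel_le h0 h1 hlam
  have hne (z : ℂ) (hz : 0 < z.re) : z + w ≠ 0 := by
    intro h
    have := congrArg re h
    rw [add_re, zero_re] at this
    linarith
  -- From `w^2 - z^2 = (z + w)(w - z)`, the factor `z + w` is harmless on the right half-plane and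
  -- only the pole at `w` counts.
  have key := integral_vertical_line_cauchy (g := fun z => mlKernel α lam z / (z + w)) (C := C')
    ((differentiableOn_mlKernel h0 h1 hlam).div (by fun_prop)
      fun z hz => hne z (mem_ofPred.1 hz)) (fun z hz => ?_) hw1
  · have e : mlKernel α lam w / (w + w) =
        w ^ ((2 * α - 2 : ℝ) : ℂ) / (w ^ ((2 * α : ℝ) : ℂ) + lam) := by
      have := hne w hw
      rw [mlKernel, ← two_mul, mul_div_right_comm, div_self, one_mul]
      rwa [two_mul]
    rw [e] at key
    rw [← key]
    congr 1 with u
    have hz := hne (1 + u * I) (by simp)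
    rw [show w ^ 2 - (1 + u * I : ℂ) ^ 2 = (1 + u * I + w) * (w - (1 + u * I)) by ring, mul_inv,
      div_eq_mul_inv, mul_assoc]
  · rw [norm_div]
    have h2 : 1 ≤ ‖z + w‖ := by
      refine le_trans ?_ (re_le_norm _)
      rw [add_re]
      linarith
    exact (div_le_self (norm_nonneg _) h2).trans (hC' z hz)

/-! ### Uniqueness of the Laplace transform. -/

open scoped FourierTransform in
/-- A continuous function on the half-line is determined by its Laplace transform. -/
theorem eq_zero_of_laplace_eq_zero {f : ℝ → ℂ} (hf : ContinuousOn f (Ioi 0)) {c : ℝ}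
    (hint : IntegrableOn (fun t : ℝ => exp (-c * t) * f t) (Ioi 0))
    (h0 : ∀ σ : ℝ, c < σ → ∫ t in Ioi (0 : ℝ), exp (-σ * t) * f t = 0) {t : ℝ} (ht : 0 < t) :
    f t = 0 := by
  have hmeas (σ : ℂ) : AEStronglyMeasurable (fun t : ℝ => exp (-σ * t) * f t)
      (volume.restrict (Ioi 0)) := by
    refine AEStronglyMeasurable.mul (Continuous.aestronglyMeasurable (by fun_prop)) ?_
    exact hf.aestronglyMeasurable measurableSet_Ioi
  have hnorm (σ : ℂ) (t : ℝ) : ‖exp (-σ * t) * f t‖ =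
      Real.exp (-(σ.re - c) * t) * ‖exp (-c * t) * f t‖ := by
    rw [norm_mul, norm_mul, norm_exp, norm_exp, ← mul_assoc, ← Real.exp_add]
    simp only [re_mul_ofReal, neg_re, ofReal_re]
    ring_nf
  have hint' (σ : ℂ) (hσ : c ≤ σ.re) :
      IntegrableOn (fun t : ℝ => exp (-σ * t) * f t) (Ioi 0) := by
    refine hint.norm.mono' (hmeas σ) ((ae_restrict_iff' measurableSet_Ioi).2
      (ae_of_all _ fun t ht => ?_))
    rw [hnorm]
    refine mul_le_of_le_one_left (norm_nonneg _) (Real.exp_le_one_iff.2 ?_)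
    have : 0 < t := ht
    nlinarith [mul_nonneg (sub_nonneg.2 hσ) this.le]
  set H : ℂ → ℂ := fun σ => ∫ t in Ioi (0 : ℝ), exp (-σ * t) * f t with hH
  have hopen : IsOpen {σ : ℂ | c < σ.re} := isOpen_lt continuous_const continuous_re
  have hdiff : DifferentiableOn ℂ H {σ : ℂ | c < σ.re} := by
    intro σ hσ
    rw [mem_ofPred_eq] at hσ
    set ε := (σ.re - c) / 2 with hε
    have hεpos : 0 < ε := by rw [hε]; linarith
    refine DifferentiableAt.differentiableWithinAt ?_
    have hnhds : {τ : ℂ | c + ε < τ.re} ∈ 𝓝 σ :=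
      (isOpen_lt continuous_const continuous_re).mem_nhds
        (by rw [mem_ofPred_eq, hε]; linarith)
    refine (hasDerivAt_integral_of_dominated_loc_of_deriv_le
      (F := fun (σ : ℂ) (t : ℝ) => exp (-σ * t) * f t)
      (F' := fun (σ : ℂ) (t : ℝ) => -(t : ℂ) * (exp (-σ * t) * f t))
      (bound := fun t : ℝ => ε⁻¹ * ‖exp (-c * t) * f t‖)
      hnhds (Eventually.of_forall hmeas) (hint' σ hσ.le) ?_ ?_ ?_
      (ae_of_all _ fun t τ _ => ?_)).2.differentiableAt
    · exact AEStronglyMeasurable.mul (Continuous.aestronglyMeasurable (by fun_prop)) (hmeas σ)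
    · refine (ae_restrict_iff' measurableSet_Ioi).2 (ae_of_all _ fun t ht τ hτ => ?_)
      have ht : 0 < t := ht
      rw [mem_ofPred_eq] at hτ
      rw [norm_mul, norm_neg, norm_real, Real.norm_of_nonneg ht.le, hnorm, ← mul_assoc]
      gcongr
      have h1 : ε * t ≤ Real.exp ((τ.re - c) * t) := by
        have := Real.add_one_le_exp ((τ.re - c) * t)
        nlinarith
      rw [neg_mul, Real.exp_neg, ← div_eq_mul_inv, div_le_iff₀ (Real.exp_pos _), inv_mul_eq_div,
        le_div_iff₀ hεpos, mul_comm]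
      exact h1
    · exact hint.norm.const_mul _
    · have h1 : HasDerivAt (fun τ : ℂ => -τ * (t : ℂ)) (-(t : ℂ)) τ := by
        simpa using (hasDerivAt_neg τ).mul_const (t : ℂ)
      refine (h1.cexp.mul_const (f t)).congr_deriv ?_
      ring
  -- The identity theorem carries the vanishing from real `σ` to the half-plane. On the line `Re σ =
  -- c + 1` the transform is the Fourier transform of `g`, and Fourier inversion at a continuity
  -- point ends the proof.
  have hzero : EqOn H 0 {σ : ℂ | c < σ.re} := by
    refine (hdiff.analyticOnNhd hopen).eqOn_zero_of_preconnected_of_frequently_eq_zero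
      (convex_halfSpace_re_gt c).isPreconnected (z₀ := ((c + 1 : ℝ) : ℂ))
      (by simp) ?_
    have hF : ∃ᶠ x : ℝ in 𝓝[>] (c + 1), H x = 0 := by
      refine Eventually.frequently ?_
      filter_upwards [self_mem_nhdsWithin] with x hx
      exact h0 x (by have : c + 1 < x := hx; linarith)
    have ht : Tendsto (fun x : ℝ => (x : ℂ)) (𝓝[>] (c + 1)) (𝓝[≠] ((c + 1 : ℝ) : ℂ)) := by
      refine tendsto_nhdsWithin_of_tendsto_nhds_of_eventually_within _
        ((continuous_ofReal.tendsto _).mono_left nhdsWithin_le_nhds) ?_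
      filter_upwards [self_mem_nhdsWithin] with x hx
      exact fun h => (ne_of_gt (mem_Ioi.1 hx)) (ofReal_injective h)
    exact ht.frequently hF
  set g : ℝ → ℂ := (Ioi (0 : ℝ)).indicator fun t => exp (-(c + 1 : ℝ) * t) * f t with hg
  have hgint : Integrable g := by
    rw [hg, integrable_indicator_iff measurableSet_Ioi]
    simpa using hint' (c + 1 : ℝ) (by simp)
  have hgF : 𝓕 g = 0 := by
    ext ξ
    rw [Real.fourier_real_eq_integral_exp_smul]
    have e (v : ℝ) : exp ((-2 * Real.pi * v * ξ : ℝ) * I) • g v = (Ioi (0 : ℝ)).indicator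
        (fun t : ℝ => exp (-((c + 1 : ℝ) + (2 * Real.pi * ξ : ℝ) * I) * t) * f t) v := by
      simp only [hg, indicator, smul_eq_mul]
      split_ifs
      · rw [← mul_assoc, ← exp_add]
        push_cast
        ring_nf
      · simp
    simp_rw [e]
    rw [integral_indicator measurableSet_Ioi]
    exact hzero (by simp)
  have hgc : ContinuousAt g t := by
    have h1 : ContinuousAt (fun t : ℝ => exp (-(c + 1 : ℝ) * t) * f t) t :=
      ContinuousAt.mul (Continuous.continuousAt (by fun_prop)) (hf.continuousAt (Ioi_mem_nhds ht))
    refine h1.congr ?_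
    filter_upwards [Ioi_mem_nhds ht] with x hx
    rw [hg, indicator_of_mem hx]
  have hinv := hgint.fourierInv_fourier_eq (by rw [hgF]; exact integrable_zero _ _ _) hgc
  rw [hgF] at hinv
  have h2 : g t = 0 := by
    rw [← hinv, Real.fourierInv_eq]
    simp
  rw [hg, indicator_of_mem (mem_Ioi.2 ht)] at h2
  exact (mul_eq_zero.1 h2).resolve_left (exp_ne_zero _)

/-! ### Growth and Laplace transform of the Mittag-Leffler function. -/

/-- Only the part `t > A` of the Gamma integral is kept. The parameter `A` is free, so that `A^α ≥
2|x|` makes the series geometric with ratio `1/2`. -/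
theorem rpow_mul_exp_neg_le_Gamma {A x : ℝ} (hA : 0 < A) (hx : 0 ≤ x) :
    A ^ x * Real.exp (-A) ≤ Real.Gamma (x + 1) := by
  rw [Real.Gamma_eq_integral (by linarith), ← integral_exp_neg_Ioi, ← integral_const_mul]
  have hi := Real.GammaIntegral_convergent (show 0 < x + 1 by linarith)
  have hsub : Ioi A ⊆ Ioi 0 := Ioi_subset_Ioi hA.le
  calc ∫ t in Ioi A, A ^ x * Real.exp (-t)
      ≤ ∫ t in Ioi A, Real.exp (-t) * t ^ (x + 1 - 1) := by
        refine setIntegral_mono_on ((integrableOn_exp_neg_Ioi A).const_mul _) (hi.mono_set hsub)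
          measurableSet_Ioi fun t ht => ?_
        rw [add_sub_cancel_right, mul_comm]
        have : A < t := ht
        gcongr
    _ ≤ _ := by
        refine setIntegral_mono_set hi ?_ hsub.eventuallyLE
        refine (ae_restrict_iff' measurableSet_Ioi).2 (ae_of_all _ fun t ht => ?_)
        have : 0 < t := ht
        simp only [Pi.zero_apply]
        positivity

theorem norm_mittagLeffler_term_le {α : ℝ} (hα : 0 < α) {A : ℝ} (hA : 0 < A) (x : ℝ) (k : ℕ) :
    ‖x ^ k / Real.Gamma (α * k + 1)‖ ≤ Real.exp A * (|x| / A ^ α) ^ k := by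
  have h1 := rpow_mul_exp_neg_le_Gamma hA (show 0 ≤ α * k by positivity)
  have h2 : 0 < A ^ (α * k) * Real.exp (-A) := by positivity
  rw [norm_div, norm_pow, Real.norm_eq_abs, Real.norm_of_nonneg (h2.trans_le h1).le]
  calc |x| ^ k / Real.Gamma (α * k + 1) ≤ |x| ^ k / (A ^ (α * k) * Real.exp (-A)) := by gcongr
    _ = _ := by
      rw [Real.rpow_mul hA.le, Real.rpow_natCast, Real.exp_neg, div_pow]
      field_simp

theorem mittagLeffler_one_eq (α x : ℝ) :
    mittagLeffler α 1 x = ∑' k : ℕ, x ^ k / Real.Gamma (α * k + 1) := by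
  simp [mittagLeffler]

theorem norm_mittagLeffler_le {α : ℝ} (hα : 0 < α) {A x : ℝ} (hA : 0 < A)
    (hx : 2 * |x| ≤ A ^ α) : ‖mittagLeffler α 1 x‖ ≤ 2 * Real.exp A := by
  have hAα : 0 < A ^ α := by positivity
  have hq : |x| / A ^ α ≤ 1 / 2 := by rw [div_le_iff₀ hAα]; linarith
  rw [mittagLeffler_one_eq]
  refine tsum_of_norm_bounded (g := fun k : ℕ => Real.exp A * (1 / 2 : ℝ) ^ k) ?_ fun k => ?_
  · rw [mul_comm]
    exact hasSum_geometric_two.mul_left _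
  · refine (norm_mittagLeffler_term_le hα hA x k).trans ?_
    gcongr

theorem continuous_mittagLeffler {α : ℝ} (hα : 0 < α) :
    Continuous fun x : ℝ => mittagLeffler α 1 x := by
  simp_rw [mittagLeffler_one_eq]
  rw [continuous_iff_continuousAt]
  intro x
  set B := |x| + 1 with hB
  have hBpos : 0 < B := by positivity
  set A := (2 * B) ^ α⁻¹ with hA
  have hApos : 0 < A := by positivity
  have hAB : A ^ α = 2 * B := by rw [hA, Real.rpow_inv_rpow (by positivity) hα.ne']
  have hon : ContinuousOn (fun x : ℝ => ∑' k : ℕ, x ^ k / Real.Gamma (α * k + 1)) (Ioo (-B) B) := by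
    refine continuousOn_tsum (u := fun k : ℕ => Real.exp A * (1 / 2 : ℝ) ^ k)
      (fun k => by fun_prop) (summable_geometric_two.mul_left _) fun k y hy => ?_
    refine (norm_mittagLeffler_term_le hα hApos y k).trans ?_
    have hy' : |y| < B := abs_lt.2 hy
    have hq : |y| / A ^ α ≤ 1 / 2 := by
      rw [hAB, div_le_iff₀ (by positivity)]
      linarith
    gcongr
  refine hon.continuousAt (Ioo_mem_nhds ?_ ?_)
  · linarith [neg_abs_le x]
  · linarith [le_abs_self x]

theorem continuous_mittagLeffler_rpow {α : ℝ} (hα : 0 < α) (lam : ℝ) :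
    Continuous fun t : ℝ => mittagLeffler α 1 (-lam * t ^ α) :=
  (continuous_mittagLeffler hα).comp (continuous_const.mul (Real.continuous_rpow_const hα.le))

theorem integrableOn_exp_mul_mittagLeffler {α lam σ : ℝ} (hα : 0 < α) (hlam : 0 < lam)
    (hσ : (2 * lam) ^ α⁻¹ < σ) :
    IntegrableOn (fun t : ℝ => Real.exp (-σ * t) * mittagLeffler α 1 (-lam * t ^ α)) (Ioi 0) := by
  set b := (2 * lam) ^ α⁻¹ with hb
  have hbpos : 0 < b := by positivity
  have h := (integrableOn_exp_mul_Ioi (sub_neg.2 hσ) 0).const_mul 2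
  refine h.mono' (Continuous.aestronglyMeasurable ?_)
    ((ae_restrict_iff' measurableSet_Ioi).2 (ae_of_all _ fun t ht => ?_))
  · exact Continuous.mul (by fun_prop) (continuous_mittagLeffler_rpow hα lam)
  · have ht : 0 < t := ht
    have h1 : ‖mittagLeffler α 1 (-lam * t ^ α)‖ ≤ 2 * Real.exp (b * t) := by
      -- With `A = (2λ)^(1/α) t`, one has `A^α = 2 λ t^α` exactly.
      refine norm_mittagLeffler_le hα (by positivity) (le_of_eq ?_)
      rw [Real.mul_rpow hbpos.le ht.le, hb, Real.rpow_inv_rpow (by positivity) hα.ne', abs_mul,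
        abs_neg, abs_of_pos hlam, abs_of_pos (by positivity)]
      ring
    rw [norm_mul, Real.norm_of_nonneg (Real.exp_pos _).le]
    calc _ ≤ Real.exp (-σ * t) * (2 * Real.exp (b * t)) := by gcongr
      _ = 2 * (Real.exp (b * t) * Real.exp (-σ * t)) := by ring
      _ = _ := by rw [← Real.exp_add]; ring_nf

theorem laplace_mittagLeffler {α lam σ : ℝ} (hα : 0 < α) (hlam : 0 < lam)
    (hσ0 : 0 < σ) (hσ : lam < σ ^ α) :
    ∫ t in Ioi (0 : ℝ), Real.exp (-σ * t) * mittagLeffler α 1 (-lam * t ^ α) =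
      σ⁻¹ * (1 + lam / σ ^ α)⁻¹ := by
  have hsα : 0 < σ ^ α := by positivity
  have hΓ (k : ℕ) : 0 < Real.Gamma (α * k + 1) := Real.Gamma_pos_of_pos (by positivity)
  have hval (k : ℕ) : ∫ t in Ioi (0 : ℝ), t ^ (α * k + 1 - 1) * Real.exp (-(σ * t)) =
      σ⁻¹ * (1 / σ ^ α) ^ k * Real.Gamma (α * k + 1) := by
    rw [Real.integral_rpow_mul_exp_neg_mul_Ioi (by positivity) hσ0,
      Real.rpow_add (by positivity), Real.rpow_one, Real.rpow_mul (by positivity),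
      Real.rpow_natCast, Real.div_rpow zero_le_one hσ0.le, Real.one_rpow]
    ring
  have hint (k : ℕ) :
      IntegrableOn (fun t : ℝ => t ^ (α * k + 1 - 1) * Real.exp (-(σ * t))) (Ioi 0) := by
    -- A non-integrable function has integral `0` by convention, so the nonzero value in `hval`
    -- forces integrability.
    refine not_imp_comm.1 integral_undef ?_
    rw [hval]
    have := hΓ k
    positivity
  have hterm (k : ℕ) (t : ℝ) (ht : 0 < t) : Real.exp (-σ * t) *
      ((-lam * t ^ α) ^ k / Real.Gamma (α * k + 1)) =
      ((-lam) ^ k / Real.Gamma (α * k + 1)) * (t ^ (α * k + 1 - 1) * Real.exp (-(σ * t))) := by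
    rw [add_sub_cancel_right, Real.rpow_mul ht.le, Real.rpow_natCast, mul_pow, neg_mul]
    ring
  have hterm_norm (k : ℕ) (t : ℝ) (ht : 0 < t) : ‖Real.exp (-σ * t) *
      ((-lam * t ^ α) ^ k / Real.Gamma (α * k + 1))‖ =
      (lam ^ k / Real.Gamma (α * k + 1)) * (t ^ (α * k + 1 - 1) * Real.exp (-(σ * t))) := by
    rw [hterm k t ht, norm_mul, norm_div, norm_pow, norm_neg, Real.norm_of_nonneg hlam.le,
      Real.norm_of_nonneg (hΓ k).le, Real.norm_of_nonneg (by positivity)]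
  have hI (k : ℕ) : ∫ t in Ioi (0 : ℝ), Real.exp (-σ * t) *
      ((-lam * t ^ α) ^ k / Real.Gamma (α * k + 1)) = σ⁻¹ * (-lam / σ ^ α) ^ k := by
    rw [setIntegral_congr_fun measurableSet_Ioi fun t ht => hterm k t ht, integral_const_mul, hval]
    have := (hΓ k).ne'
    rw [div_pow, div_pow, one_pow]
    field_simp
  have hN (k : ℕ) : ∫ t in Ioi (0 : ℝ), ‖Real.exp (-σ * t) *
      ((-lam * t ^ α) ^ k / Real.Gamma (α * k + 1))‖ = σ⁻¹ * (lam / σ ^ α) ^ k := by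
    rw [setIntegral_congr_fun measurableSet_Ioi fun t ht => hterm_norm k t ht,
      integral_const_mul, hval]
    have := (hΓ k).ne'
    rw [div_pow, div_pow, one_pow]
    field_simp
  have hq : lam / σ ^ α < 1 := (div_lt_one hsα).2 hσ
  have hsum := hasSum_integral_of_summable_integral_norm (μ := volume.restrict (Ioi (0 : ℝ)))
    (F := fun (k : ℕ) (t : ℝ) => Real.exp (-σ * t) *
      ((-lam * t ^ α) ^ k / Real.Gamma (α * k + 1)))
    (fun k => IntegrableOn.congr_fun ((hint k).const_mul _) (fun t ht => (hterm k t ht).symm)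
      measurableSet_Ioi)
    (by
      simp_rw [hN]
      exact (summable_geometric_of_lt_one (by positivity) hq).mul_left _)
  simp_rw [hI, tsum_mul_left, ← mittagLeffler_one_eq] at hsum
  refine hsum.unique ?_
  have := (hasSum_geometric_of_abs_lt_one (r := -lam / σ ^ α) (by
    rw [abs_div, abs_neg, abs_of_pos hlam, abs_of_pos hsα]
    exact hq)).mul_left σ⁻¹
  rwa [neg_div, sub_neg_eq_add, ← neg_div] at this

/-! ### Contour representation and conclusion. -/

theorem mlKernel_symbol_ofReal {α lam w : ℝ} (hlam : 0 < lam) (hw : 0 < w) :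
    (w : ℂ) ^ ((2 * α - 2 : ℝ) : ℂ) / ((w : ℂ) ^ ((2 * α : ℝ) : ℂ) + lam) =
      (((w ^ 2)⁻¹ * (1 + lam / (w ^ 2) ^ α)⁻¹ : ℝ) : ℂ) := by
  rw [← ofReal_cpow hw.le, ← ofReal_cpow hw.le, ← ofReal_add, ← ofReal_div]
  congr 1
  have h1 : (w ^ 2) ^ α = w ^ (2 * α) := by rw [Real.rpow_mul hw.le, Real.rpow_ofNat]
  have h2 : w ^ (2 * α - 2) = w ^ (2 * α) / w ^ 2 := by rw [Real.rpow_sub hw, Real.rpow_ofNat]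
  have h3 : 0 < w ^ (2 * α) := by positivity
  rw [h1, h2]
  field_simp

/-- The contour integral representation of the Mittag-Leffler function. -/
theorem parabolaIntegral_mlKernel {α lam t : ℝ} (h0 : 0 < α) (h1 : α ≤ 1) (hlam : 0 < lam)
    (ht : 0 < t) :
    parabolaIntegral (fun u => mlKernel α lam (1 + u * I)) t =
      ((2 * Real.pi * mittagLeffler α 1 (-lam * t ^ α) : ℝ) : ℂ) := by
  obtain ⟨C, hC⟩ := norm_mlKernel_line_le h0 h1 hlam.le
  have hk := continuous_mlKernel_line h0 h1 hlam.le
  set k : ℝ → ℂ := fun u => mlKernel α lam (1 + u * I) with hkdef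
  -- The `2` serves the parabola side; the other term exceeds the exponential growth rate of the
  -- Mittag-Leffler side and gives `2λ ≤ σ^α`.
  set c : ℝ := 2 + (2 * lam) ^ α⁻¹ with hc
  have hb : 0 < (2 * lam) ^ α⁻¹ := by positivity
  have hint1 (σ : ℝ) (hσ : c ≤ σ) :
      IntegrableOn (fun t : ℝ => exp (-σ * t) * parabolaIntegral k t) (Ioi 0) :=
    integrableOn_exp_mul_parabolaIntegral hk hC (by rw [ofReal_re]; linarith)
  have hcast (σ t : ℝ) : exp (-σ * t) * ((2 * Real.pi * mittagLeffler α 1 (-lam * t ^ α) : ℝ) : ℂ) =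
      2 * Real.pi * ((Real.exp (-σ * t) * mittagLeffler α 1 (-lam * t ^ α) : ℝ) : ℂ) := by
    push_cast
    ring
  have hint2 (σ : ℝ) (hσ : c ≤ σ) : IntegrableOn (fun t : ℝ => exp (-σ * t) *
      ((2 * Real.pi * mittagLeffler α 1 (-lam * t ^ α) : ℝ) : ℂ)) (Ioi 0) := by
    simp_rw [hcast]
    exact (integrableOn_exp_mul_mittagLeffler h0 hlam (by linarith)).ofReal.const_mul _
  rw [← sub_eq_zero]
  refine eq_zero_of_laplace_eq_zero (c := c)
    (f := fun t => parabolaIntegral k t -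
      ((2 * Real.pi * mittagLeffler α 1 (-lam * t ^ α) : ℝ) : ℂ)) ?_ ?_ ?_ ht
  · refine ContinuousOn.sub (fun s hs => ?_) (Continuous.continuousOn ?_)
    · exact (hasDerivAt_parabolaIntegral hk (n := 0) (C := C) (by simpa using hC)
        hs).continuousAt.continuousWithinAt
    · exact continuous_ofReal.comp (continuous_const.mul (continuous_mittagLeffler_rpow h0 lam))
  · simp_rw [mul_sub]
    exact (hint1 c le_rfl).sub (hint2 c le_rfl)
  · intro σ hσ
    have hσ0 : 0 < σ := by linarith
    have hsq : √σ ^ 2 = σ := Real.sq_sqrt hσ0.le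
    have hw : 0 < √σ := Real.sqrt_pos.2 hσ0
    simp_rw [mul_sub]
    rw [integral_sub (hint1 σ hσ.le) (hint2 σ hσ.le)]
    simp_rw [hcast]
    rw [integral_const_mul, integral_complex_ofReal, laplace_mittagLeffler h0 hlam hσ0]
    · have hL := laplace_parabolaIntegral_mlKernel h0 h1 hlam.le (w := (√σ : ℝ)) (by simpa using hw)
        (by rw [← ofReal_pow, hsq, ofReal_re]; linarith)
      rw [mlKernel_symbol_ofReal hlam hw, ← ofReal_pow, hsq] at hL
      rw [hL, sub_self]
    · have h2 : (2 * lam) ^ α⁻¹ ≤ σ := by linarith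
      have h3 : 2 * lam ≤ σ ^ α :=
        (Real.rpow_inv_le_iff_of_pos (by positivity) hσ0.le h0).1 h2
      linarith

theorem mittagLeffler_one_one (x : ℝ) : mittagLeffler 1 1 x = Real.exp x := by
  rw [mittagLeffler_one_eq, Real.exp_eq_exp_ℝ, NormedSpace.exp_eq_tsum_div]
  simp [Real.Gamma_nat_eq_factorial]

theorem parabolaIntegral_mlKernel_sub {α lam t : ℝ} (h0 : 0 < α) (h1 : α ≤ 1) (hlam : 0 < lam)
    (ht : 0 < t) :
    parabolaIntegral (fun u => mlKernel α lam (1 + u * I) - mlKernel 1 lam (1 + u * I)) t =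
      ((2 * Real.pi * mlExpDiff α lam t : ℝ) : ℂ) := by
  have hi {β : ℝ} (h0 : 0 < β) (h1 : β ≤ 1) :
      Integrable fun u : ℝ => exp (t * (1 + u * I : ℂ) ^ 2) * mlKernel β lam (1 + u * I) := by
    obtain ⟨C, hC⟩ := norm_mlKernel_line_le h0 h1 hlam.le
    exact integrable_exp_mul (continuous_mlKernel_line h0 h1 hlam.le) (n := 0) (C := C)
      (by simpa using hC) ht
  have e1 := parabolaIntegral_mlKernel h0 h1 hlam ht
  have e2 := parabolaIntegral_mlKernel one_pos le_rfl hlam ht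
  unfold parabolaIntegral at *
  simp_rw [mul_sub]
  rw [integral_sub (hi h0 h1) (hi one_pos le_rfl), e1, e2, mlExpDiff, Real.rpow_one,
    mittagLeffler_one_one]
  push_cast
  ring

theorem mainTheorem3 (l L α₀ : ℝ) (hl : 0 < l) (hlL : l < L) (hα₀ : α₀ ∈ Ioo (0 : ℝ) 1) :
    ∃ Ctilde > (0 : ℝ), ∃ Chat > (0 : ℝ),
      ∀ lam₁ ≥ (0 : ℝ), ∀ α ∈ Ico α₀ 1, ∀ lam > lam₁,
        eLpNorm (mlExpDiff α lam) ∞ (volume.restrict (Ioo l L))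
            ≤ ENNReal.ofReal (Ctilde * (1 - α)) ∧
        (∀ t ∈ Icc l L, DifferentiableAt ℝ (mlExpDiff α lam) t) ∧
        eLpNorm (deriv (mlExpDiff α lam)) ∞ (volume.restrict (Ioo l L))
            ≤ ENNReal.ofReal (Chat * lam * (1 - α)) := by
  -- The power `3` fits both estimates: `|z|^6` for the function, and `|z|^2 · |z|^4` for the
  -- derivative.
  set M := Real.exp (L - l) * ∫ u : ℝ, Real.exp (l * (1 - u ^ 2)) * (1 + u ^ 2) ^ 3 with hM
  have hM0 : 0 ≤ M := mul_nonneg (Real.exp_pos _).le (integral_nonneg fun u => by positivity)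
  -- The `+ 1` only makes the constants visibly positive; the gain from dividing by `2π` is
  -- discarded.
  refine ⟨32 * M + 1, by positivity, 16 * M + 1, by positivity, ?_⟩
  intro lam₁ hlam₁ α hα lam hlam
  have hlam0 : 0 < lam := lt_of_le_of_lt hlam₁ hlam
  have h0 : 0 < α := hα₀.1.trans_le hα.1
  have h1 : α < 1 := hα.2
  have h1' : 0 ≤ 1 - α := by linarith
  set k : ℝ → ℂ := fun u => mlKernel α lam (1 + u * I) - mlKernel 1 lam (1 + u * I) with hk
  have hkc : Continuous k := (continuous_mlKernel_line h0 h1.le hlam0.le).sub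
    (continuous_mlKernel_line one_pos le_rfl hlam0.le)
  have hk1 (u : ℝ) : ‖k u‖ ≤ 32 * (1 - α) * (1 + u ^ 2) ^ 3 := by
    rw [← norm_one_add_mul_I_sq, ← pow_mul]
    exact norm_mlKernel_sub_le h0 h1.le (by simp) hlam0.le
  have hk2 (u : ℝ) : ‖(1 + u * I : ℂ) ^ 2 * k u‖ ≤ 16 * lam * (1 - α) * (1 + u ^ 2) ^ 3 := by
    have := norm_mlKernel_sub_le_mul h0 h1.le (z := 1 + u * I) (by simp) hlam0.le
    rw [norm_mul, norm_pow, ← norm_one_add_mul_I_sq]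
    calc _ ≤ ‖(1 + u * I : ℂ)‖ ^ 2 * (16 * lam * (1 - α) * ‖(1 + u * I : ℂ)‖ ^ 4) := by gcongr
      _ = _ := by ring
  have hpi : 1 ≤ 2 * Real.pi := by linarith [Real.pi_gt_three]
  have hd (t : ℝ) (ht : 0 < t) : HasDerivAt (mlExpDiff α lam)
      ((parabolaIntegral (fun u => (1 + u * I : ℂ) ^ 2 * k u) t).re / (2 * Real.pi)) t := by
    have h2 := (reCLM.hasFDerivAt.comp_hasDerivAt t
      (hasDerivAt_parabolaIntegral hkc hk1 ht)).div_const (2 * Real.pi)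
    refine h2.congr_of_eventuallyEq ?_
    filter_upwards [Ioi_mem_nhds ht] with s hs
    simp only [Function.comp_apply, reCLM_apply]
    rw [parabolaIntegral_mlKernel_sub h0 h1.le hlam0 hs, ofReal_re]
    field_simp
  refine ⟨?_, fun t ht => (hd t (hl.trans_le ht.1)).differentiableAt, ?_⟩
  · rw [eLpNorm_exponent_top]
    refine eLpNormEssSup_le_of_ae_bound ((ae_restrict_iff' measurableSet_Ioo).2
      (ae_of_all _ fun t ht => ?_))
    have h2 := norm_parabolaIntegral_le hk1 hl ht.1.le ht.2.le
    rw [parabolaIntegral_mlKernel_sub h0 h1.le hlam0 (hl.trans ht.1), norm_real, norm_mul,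
      Real.norm_of_nonneg (by positivity : 0 ≤ 2 * Real.pi), mul_assoc (32 * (1 - α)), ← hM] at h2
    have h3 := norm_nonneg (mlExpDiff α lam t)
    nlinarith
  · rw [eLpNorm_exponent_top]
    refine eLpNormEssSup_le_of_ae_bound ((ae_restrict_iff' measurableSet_Ioo).2
      (ae_of_all _ fun t ht => ?_))
    have h2 := norm_parabolaIntegral_le hk2 hl ht.1.le ht.2.le
    rw [mul_assoc, ← hM] at h2
    rw [(hd t (hl.trans ht.1)).deriv, norm_div, Real.norm_of_nonneg (by positivity : 0 ≤ 2 * Real.pi)]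
    refine (div_le_self (norm_nonneg _) hpi).trans ?_
    refine ((abs_re_le_norm _).trans h2).trans ?_
    have : 0 ≤ lam * (1 - α) := by positivity
    nlinarith
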